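/- Let $\psi(x)=\Gamma'(x)/\Gamma(x)$ be the digamma function, $\gamma$ Euler's constant, and for $x>0$ put $$\phi(x):=\psi(x)+\frac{1}{2x}-\log x .$$ Let $\xi(s)=\tfrac12 s(s-1)\pi^{-s/2}\Gamma\!\left(\tfrac s2\right)\zeta(s)$ and $\Xi(t)=\xi\!\left(\tfrac12+it\right)$ be the Riemann functions. Then for all real $\alpha,\beta>0$ with $\alpha\beta=1$, the two series and the integral below converge absolutely and $$\sqrt{\alpha}\left\{\frac{\gamma-\log(2\pi\alpha)}{2\alpha}+\sum_{n=1}^{\infty}\phi(n\alpha)\right\} =\sqrt{\beta}\left\{\frac{\gamma-\log(2\pi\beta)}{2\beta}+\sum_{n=1}^{\infty}\phi(n\beta)\right\} =-\frac{1}{\pi^{3/2}}\int_0^{\infty}\left|\Xi\!\left(\frac t2\right)\Gamma\!\left(\frac{-1+it}{4}\right)\right|^2\frac{\cos\!\left(\frac t2\log\alpha\right)}{1+t^2}\,dt .$$ -/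

import Mathlib

namespace LostNotebook

/-- The digamma function `ψ(x) = Γ'(x) / Γ(x)` of a real variable (used for `x > 0`). -/
noncomputable def digamma (x : ℝ) : ℝ := deriv Real.Gamma x / Real.Gamma x

/-- `φ(x) = ψ(x) + 1/(2x) - log x` (used for `x > 0`). -/
noncomputable def phi (x : ℝ) : ℝ := digamma x + 1 / (2 * x) - Real.log x

/-- Riemann's function `ξ(s) = (1/2) s (s - 1) π^(-s/2) Γ(s/2) ζ(s)`, literally by this formula
wherever its factors are finite; it is only used on the critical line `Re s = 1/2`. -/
noncomputable def xi (s : ℂ) : ℂ :=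
  (1 / 2) * s * (s - 1) * (Real.pi : ℂ) ^ (-s / 2) * Complex.Gamma (s / 2) * riemannZeta s

/-- Riemann's function `Ξ(t) = ξ(1/2 + i t)` for real `t`. -/
noncomputable def Xi (t : ℝ) : ℂ := xi (1 / 2 + Complex.I * t)

/-- The function `√α { (γ - log (2πα)) / (2α) + ∑_{n ≥ 1} φ(nα) }`. -/
noncomputable def modularSide (α : ℝ) : ℝ :=
  √α * ((Real.eulerMascheroniConstant - Real.log (2 * Real.pi * α)) / (2 * α)
    + ∑' n : ℕ, phi (((n : ℝ) + 1) * α))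

/-- The integrand `|Ξ(t/2) Γ((-1 + i t)/4)|² cos((t/2) log α) / (1 + t²)`. -/
noncomputable def xiIntegrand (α t : ℝ) : ℝ :=
  ‖Xi (t / 2) * Complex.Gamma ((-1 + Complex.I * t) / 4)‖ ^ 2
    * Real.cos (t / 2 * Real.log α) / (1 + t ^ 2)

end LostNotebook

namespace LostNotebook

open Real Set Filter Topology MeasureTheory

/-! Write R for `boseReg` and K = R + 1/2 for `binetKernel`. Everything follows from
`modularSide_eq_integral`: the modular side at a equals -√a ∫₀^∞ R(ax) R(x) dx, which the
substitution x ↦ x/a shows to be invariant under a ↦ 1/a. To reach this form, Binet's formula writes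
φ(y) as minus the Laplace transform of K, and a geometric series gives ∑ φ(na) = -∫ K(x)/(e^{ax} -
1) dx (`hasSum_phi`). What separates this from the integral of R(ax) R(x) is an elementary integral,
evaluated in `integral_binetKernel_div_add`; it supplies the term with γ and log(2πa). With x =
e^{-u} the integral becomes the autocorrelation of `boseLog` at log a, so by Wiener-Khinchin it is
the cosine transform of the squared modulus of a Fourier transform. That transform is the Mellin
transform of R on the critical line, namely Γ(s)ζ(s) (`hasMellin_boseReg`), and the duplication
formula turns |Γζ|² into |Ξ Γ|²/(1 + t²) up to a constant (`norm_Xi_mul_Gamma_sq`). -/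

/-- The regularised Bose function `1 / (e^x - 1) - 1 / x`. -/
noncomputable def boseReg (x : ℝ) : ℝ := 1 / (exp x - 1) - 1 / x

/-- The kernel `1 / (e^x - 1) - 1 / x + 1 / 2` of Binet's first formula. -/
noncomputable def binetKernel (x : ℝ) : ℝ := boseReg x + 1 / 2

/-! ### Elementary bounds for the Bose kernels -/

lemma sinh_le_self_mul_cosh {y : ℝ} (hy : 0 ≤ y) : sinh y ≤ y * cosh y := by
  have hd : ∀ x : ℝ, HasDerivAt (fun x => x * cosh x - sinh x) (x * sinh x) x := fun x => by
    have := ((hasDerivAt_id x).mul (hasDerivAt_cosh x)).sub (hasDerivAt_sinh x)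
    refine this.congr_deriv ?_
    simp
  have hm : MonotoneOn (fun x => x * cosh x - sinh x) (Ici 0) := by
    apply monotoneOn_of_deriv_nonneg (convex_Ici 0)
    · exact fun x _ => (hd x).continuousAt.continuousWithinAt
    · exact fun x _ => (hd x).differentiableAt.differentiableWithinAt
    · intro x hx
      rw [interior_Ici] at hx
      rw [(hd x).deriv]
      exact mul_nonneg hx.le (sinh_nonneg_iff.2 (mem_Ioi.1 hx).le)
  have := hm self_mem_Ici (mem_Ici.2 hy) hy
  simp at this
  linarith

lemma exp_sub_one_eq_sinh (y : ℝ) : exp (2 * y) - 1 = 2 * exp y * sinh y := by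
  rw [sinh_eq, two_mul y, exp_add]
  have : exp y * exp (-y) = 1 := by rw [← exp_add]; simp
  linear_combination this

lemma exp_add_one_eq_cosh (y : ℝ) : exp (2 * y) + 1 = 2 * exp y * cosh y := by
  rw [cosh_eq, two_mul y, exp_add]
  have : exp y * exp (-y) = 1 := by rw [← exp_add]; simp
  linear_combination -this

lemma exp_sub_one_pos {x : ℝ} (hx : 0 < x) : 0 < exp x - 1 := by
  linarith [add_one_lt_exp hx.ne']

lemma binetKernel_nonneg {x : ℝ} (hx : 0 < x) : 0 ≤ binetKernel x := by
  have h0 := exp_sub_one_pos hx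
  have h1 := sinh_le_self_mul_cosh (y := x / 2) (by linarith)
  have h2 := exp_sub_one_eq_sinh (x / 2)
  have h3 := exp_add_one_eq_cosh (x / 2)
  rw [show 2 * (x / 2) = x by ring] at h2 h3
  have h4 : 2 * (exp x - 1) ≤ x * (exp x + 1) := by
    rw [h2, h3]
    have := mul_le_mul_of_nonneg_left h1 (exp_pos (x / 2)).le
    nlinarith
  have : binetKernel x = (x * (exp x + 1) - 2 * (exp x - 1)) / (2 * x * (exp x - 1)) := by
    unfold binetKernel boseReg
    field_simp
    ring
  rw [this]
  exact div_nonneg (by linarith) (by positivity)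

/-- Comes from e^x - 1 ≥ x + x²/2. Besides the sign of `boseReg` it yields the linear vanishing of
`binetKernel` at 0. -/
lemma boseReg_le {x : ℝ} (hx : 0 < x) : boseReg x ≤ -(1 / (x + 2)) := by
  have h0 := exp_sub_one_pos hx
  have h1 := quadratic_le_exp_of_nonneg hx.le
  have h2 : 1 / (exp x - 1) ≤ 1 / (x + x ^ 2 / 2) :=
    one_div_le_one_div_of_le (by positivity) (by linarith)
  have h3 : 1 / (x + x ^ 2 / 2) - 1 / x = -(1 / (x + 2)) := by
    field_simp
    ring
  unfold boseReg
  linarith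

lemma boseReg_nonpos {x : ℝ} (hx : 0 < x) : boseReg x ≤ 0 :=
  (boseReg_le hx).trans (by rw [neg_nonpos]; positivity)

lemma abs_boseReg_le_half {x : ℝ} (hx : 0 < x) : |boseReg x| ≤ 1 / 2 := by
  have h := binetKernel_nonneg hx
  rw [abs_of_nonpos (boseReg_nonpos hx)]
  unfold binetKernel at h
  linarith

lemma abs_boseReg_le_inv {x : ℝ} (hx : 0 < x) : |boseReg x| ≤ 1 / x := by
  have h0 : 0 < 1 / (exp x - 1) := one_div_pos.2 (exp_sub_one_pos hx)
  rw [abs_of_nonpos (boseReg_nonpos hx)]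
  unfold boseReg
  linarith

lemma binetKernel_le_half {x : ℝ} (hx : 0 < x) : binetKernel x ≤ 1 / 2 := by
  have := boseReg_nonpos hx
  unfold binetKernel
  linarith

lemma binetKernel_le_quarter_mul {x : ℝ} (hx : 0 < x) : binetKernel x ≤ x / 4 := by
  have h1 := boseReg_le hx
  have h2 : -(1 / (x + 2)) + 1 / 2 ≤ x / 4 := by
    rw [← sub_nonneg]
    have : x / 4 - (-(1 / (x + 2)) + 1 / 2) = x ^ 2 / (4 * (x + 2)) := by
      field_simp
      ring
    rw [this]
    positivity
  unfold binetKernel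
  linarith

/-- The derivative of `boseReg`. -/
noncomputable def boseRegDeriv (x : ℝ) : ℝ := -(exp x / (exp x - 1) ^ 2) + 1 / x ^ 2

lemma hasDerivAt_boseReg {x : ℝ} (hx : 0 < x) : HasDerivAt boseReg (boseRegDeriv x) x := by
  have h0 := exp_sub_one_pos hx
  have h1 := ((hasDerivAt_exp x).sub_const 1).inv h0.ne'
  have h2 := hasDerivAt_inv hx.ne'
  have := h1.sub h2
  refine (this.congr_deriv ?_).congr_of_eventuallyEq (Eventually.of_forall fun y => ?_)
  · unfold boseRegDeriv
    field_simp
    ring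
  · simp [boseReg]

lemma continuousOn_boseReg : ContinuousOn boseReg (Ioi 0) := fun _ hx =>
  (hasDerivAt_boseReg hx).continuousAt.continuousWithinAt

lemma continuousOn_binetKernel : ContinuousOn binetKernel (Ioi 0) :=
  continuousOn_boseReg.add continuousOn_const

lemma boseRegDeriv_eq_sinh (x : ℝ) :
    boseRegDeriv x = 1 / x ^ 2 - 1 / (4 * sinh (x / 2) ^ 2) := by
  have h2 := exp_sub_one_eq_sinh (x / 2)
  rw [show 2 * (x / 2) = x by ring] at h2
  have h3 : exp x = exp (x / 2) * exp (x / 2) := by rw [← exp_add]; ring_nf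
  have : exp x / (exp x - 1) ^ 2 = 1 / (4 * sinh (x / 2) ^ 2) := by
    rw [h2, h3]
    have := exp_pos (x / 2)
    field_simp
    norm_num
  unfold boseRegDeriv
  rw [this]
  ring

lemma boseRegDeriv_nonneg {x : ℝ} (hx : 0 < x) : 0 ≤ boseRegDeriv x := by
  rw [boseRegDeriv_eq_sinh, sub_nonneg]
  have h1 : x / 2 ≤ sinh (x / 2) := self_le_sinh_iff.2 (by linarith)
  apply one_div_le_one_div_of_le (by positivity)
  nlinarith

lemma boseRegDeriv_le_inv_sq (x : ℝ) : boseRegDeriv x ≤ 1 / x ^ 2 := by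
  rw [boseRegDeriv_eq_sinh]
  have : 0 ≤ 1 / (4 * sinh (x / 2) ^ 2) := by positivity
  linarith

lemma boseRegDeriv_le_quarter {x : ℝ} (hx : 0 < x) : boseRegDeriv x ≤ 1 / 4 := by
  rw [boseRegDeriv_eq_sinh]
  set y := x / 2 with hy
  have hy0 : 0 < y := by positivity
  have hxy : x = 2 * y := by rw [hy]; ring
  have hs : 0 < sinh y := sinh_pos_iff.2 hy0
  have h1 := sinh_le_self_mul_cosh hy0.le
  have h2 : sinh y ^ 2 ≤ y ^ 2 * (1 + sinh y ^ 2) := by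
    have := pow_le_pow_left₀ hs.le h1 2
    rw [mul_pow, cosh_sq'] at this
    exact this
  have h3 : 1 / 4 - (1 / x ^ 2 - 1 / (4 * sinh y ^ 2)) =
      (y ^ 2 * (1 + sinh y ^ 2) - sinh y ^ 2) / (4 * y ^ 2 * sinh y ^ 2) := by
    rw [hxy]
    field_simp
    ring
  have h4 : 0 ≤ 1 / 4 - (1 / x ^ 2 - 1 / (4 * sinh y ^ 2)) := by
    rw [h3]
    exact div_nonneg (by linarith) (by positivity)
  linarith

/-! ### Laplace integrals and an integrability criterion -/

lemma integrableOn_exp_neg_mul {y : ℝ} (hy : 0 < y) :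
    IntegrableOn (fun x => exp (-y * x)) (Ioi 0) :=
  integrableOn_exp_mul_Ioi (neg_lt_zero.2 hy) 0

lemma integral_exp_neg_mul {y : ℝ} (hy : 0 < y) : ∫ x in Ioi 0, exp (-y * x) = 1 / y := by
  rw [integral_exp_mul_Ioi (neg_lt_zero.2 hy)]
  simp

lemma integrableOn_mul_exp_neg_mul {f : ℝ → ℝ} {C y : ℝ} (hf : ContinuousOn f (Ioi 0))
    (hC : ∀ x, 0 < x → |f x| ≤ C) (hy : 0 < y) :
    IntegrableOn (fun x => f x * exp (-y * x)) (Ioi 0) := by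
  refine ((integrableOn_exp_neg_mul hy).const_mul C).mono' ?_ ?_
  · exact (hf.mul (by fun_prop)).aestronglyMeasurable measurableSet_Ioi
  · filter_upwards [ae_restrict_mem measurableSet_Ioi] with x hx
    rw [norm_mul, norm_eq_abs, norm_eq_abs, abs_of_pos (exp_pos _)]
    exact mul_le_mul_of_nonneg_right (hC x hx) (exp_pos _).le

lemma abs_integral_mul_exp_neg_mul_le {f : ℝ → ℝ} {C y : ℝ}
    (hC : ∀ x, 0 < x → |f x| ≤ C) (hy : 0 < y) :
    |∫ x in Ioi 0, f x * exp (-y * x)| ≤ C / y := by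
  have h := norm_integral_le_of_norm_le (μ := volume.restrict (Ioi 0))
    (f := fun x => f x * exp (-y * x)) ((integrableOn_exp_neg_mul hy).const_mul C) ?_
  · rw [integral_const_mul, integral_exp_neg_mul hy, mul_one_div] at h
    exact h
  · filter_upwards [ae_restrict_mem measurableSet_Ioi] with x hx
    rw [norm_mul, norm_eq_abs, norm_eq_abs, abs_of_pos (exp_pos _)]
    exact mul_le_mul_of_nonneg_right (hC x hx) (exp_pos _).le

lemma integrableOn_Ioi_of_le_inv_sq {f : ℝ → ℝ} {C D : ℝ} (hf : ContinuousOn f (Ioi 0))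
    (hC : ∀ x, 0 < x → |f x| ≤ C) (hD : ∀ x, 0 < x → |f x| ≤ D / x ^ 2) :
    IntegrableOn f (Ioi 0) := by
  rw [← Ioc_union_Ioi_eq_Ioi zero_le_one]
  refine IntegrableOn.union ?_ ?_
  · refine IntegrableOn.of_bound (by simp)
      ((hf.mono Ioc_subset_Ioi_self).aestronglyMeasurable measurableSet_Ioc) C ?_
    filter_upwards [ae_restrict_mem measurableSet_Ioc] with x hx using hC x hx.1
  · have h1 : IntegrableOn (fun x : ℝ => D * x ^ (-2 : ℝ)) (Ioi 1) :=
      (integrableOn_Ioi_rpow_of_lt (by norm_num) one_pos).const_mul D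
    refine h1.mono' ?_ ?_
    · exact (hf.mono (Ioi_subset_Ioi zero_le_one)).aestronglyMeasurable measurableSet_Ioi
    · filter_upwards [ae_restrict_mem measurableSet_Ioi] with x hx
      have hx0 : 0 < x := one_pos.trans hx
      have := hD x hx0
      rw [rpow_neg hx0.le, rpow_two]
      exact this

lemma abs_binetKernel_le_half {x : ℝ} (hx : 0 < x) : |binetKernel x| ≤ 1 / 2 := by
  rw [abs_of_nonneg (binetKernel_nonneg hx)]
  exact binetKernel_le_half hx

/-! ### Binet's formula for the digamma function -/

/-- The Laplace transform of the Binet kernel. -/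
noncomputable def binetLaplace (y : ℝ) : ℝ := ∫ x in Ioi 0, binetKernel x * exp (-y * x)

lemma integrableOn_binetKernel_mul_exp {y : ℝ} (hy : 0 < y) :
    IntegrableOn (fun x => binetKernel x * exp (-y * x)) (Ioi 0) :=
  integrableOn_mul_exp_neg_mul continuousOn_binetKernel (fun _ => abs_binetKernel_le_half) hy

lemma binetLaplace_nonneg (y : ℝ) : 0 ≤ binetLaplace y :=
  setIntegral_nonneg measurableSet_Ioi fun _ hx =>
    mul_nonneg (binetKernel_nonneg hx) (exp_pos _).le

lemma binetLaplace_le {y : ℝ} (hy : 0 < y) : binetLaplace y ≤ 1 / (2 * y) := by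
  refine (le_abs_self _).trans ((abs_integral_mul_exp_neg_mul_le
    (fun _ => abs_binetKernel_le_half) hy).trans_eq ?_)
  field_simp

/-- The difference puts a factor 1 - e^{-x} in the integrand, which cancels the denominator e^x - 1.
Two exponentials and a Frullani integral remain. -/
lemma binetLaplace_sub_add_one {y : ℝ} (hy : 0 < y) :
    binetLaplace y - binetLaplace (y + 1) =
      1 / (2 * y) + 1 / (2 * (y + 1)) - (log (y + 1) - log y) := by
  have hy1 : 0 < y + 1 := by linarith
  have hid : ∀ x ∈ Ioi (0 : ℝ), x⁻¹ • (exp (-(y * x)) - exp (-((y + 1) * x))) =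
      (1 / 2 * exp (-y * x) + 1 / 2 * exp (-(y + 1) * x)) -
      (binetKernel x * exp (-y * x) - binetKernel x * exp (-(y + 1) * x)) := by
    intro x hx
    have h0 := exp_sub_one_pos hx
    have hx' : x ≠ 0 := (mem_Ioi.1 hx).ne'
    have h1 : exp (-(y + 1) * x) = exp (-y * x) * (exp x)⁻¹ := by
      rw [← exp_neg, ← exp_add]; ring_nf
    rw [show -(y * x) = -y * x by ring, show -((y + 1) * x) = -(y + 1) * x by ring, h1]
    unfold binetKernel boseReg
    have := exp_pos x
    rw [smul_eq_mul]
    field_simp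
    ring
  have i1 : IntegrableOn (fun x => 1 / 2 * exp (-y * x) + 1 / 2 * exp (-(y + 1) * x)) (Ioi 0) :=
    ((integrableOn_exp_neg_mul hy).const_mul (1 / 2)).add
    ((integrableOn_exp_neg_mul hy1).const_mul (1 / 2))
  have i2 : IntegrableOn (fun x => binetKernel x * exp (-y * x) -
      binetKernel x * exp (-(y + 1) * x)) (Ioi 0) :=
    (integrableOn_binetKernel_mul_exp hy).sub (integrableOn_binetKernel_mul_exp hy1)
  have hF := Frullani.integral_Ioi_eq (f := fun x => exp (-x)) (a := y) (b := y + 1)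
    (L := 1) (R := 0) ?_ hy hy1 ?_ ?_ ?_
  · rw [setIntegral_congr_fun measurableSet_Ioi hid, integral_sub i1 i2, integral_add
      ((integrableOn_exp_neg_mul hy).const_mul (1 / 2))
      ((integrableOn_exp_neg_mul hy1).const_mul (1 / 2)), integral_sub
      (integrableOn_binetKernel_mul_exp hy) (integrableOn_binetKernel_mul_exp hy1),
      integral_const_mul, integral_const_mul, integral_exp_neg_mul hy, integral_exp_neg_mul hy1,
      log_div hy1.ne' hy.ne'] at hF
    simp only [smul_eq_mul, sub_zero, mul_one] at hF
    have e1 : 1 / (2 * y) = 1 / 2 * (1 / y) := by field_simp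
    have e2 : 1 / (2 * (y + 1)) = 1 / 2 * (1 / (y + 1)) := by field_simp
    unfold binetLaplace
    rw [e1, e2]
    linarith
  · exact Continuous.locallyIntegrable (by fun_prop) |>.locallyIntegrableOn _
  · have : Tendsto (fun x : ℝ => exp (-x)) (𝓝 0) (𝓝 (exp (-0))) :=
      Continuous.tendsto (by fun_prop) 0
    rw [neg_zero, exp_zero] at this
    exact this.mono_left nhdsWithin_le_nhds
  · exact tendsto_exp_neg_atTop_nhds_zero
  · exact IntegrableOn.congr_fun (i1.sub i2) (fun x hx => (hid x hx).symm) measurableSet_Ioi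

lemma differentiableAt_Gamma_of_pos {y : ℝ} (hy : 0 < y) : DifferentiableAt ℝ Real.Gamma y :=
  differentiableOn_Gamma_Ioi.differentiableAt (Ioi_mem_nhds hy)

lemma hasDerivAt_log_Gamma {y : ℝ} (hy : 0 < y) :
    HasDerivAt (fun x => log (Real.Gamma x)) (digamma y) y :=
  (differentiableAt_Gamma_of_pos hy).hasDerivAt.log (Gamma_pos_of_pos hy).ne'

lemma log_Gamma_add_one {y : ℝ} (hy : 0 < y) :
    log (Real.Gamma (y + 1)) = log y + log (Real.Gamma y) := by
  rw [Real.Gamma_add_one hy.ne', log_mul hy.ne' (Gamma_pos_of_pos hy).ne']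

lemma digamma_add_one {y : ℝ} (hy : 0 < y) : digamma (y + 1) = digamma y + 1 / y := by
  have h1 : HasDerivAt (fun x => log (Real.Gamma (x + 1))) (digamma (y + 1)) y :=
    (hasDerivAt_log_Gamma (by linarith : 0 < y + 1)).comp_add_const y 1
  have h2 : HasDerivAt (fun x => log x + log (Real.Gamma x)) (y⁻¹ + digamma y) y :=
    (hasDerivAt_log hy.ne').add (hasDerivAt_log_Gamma hy)
  have h3 := h2.congr_of_eventuallyEq (f₁ := fun x => log (Real.Gamma (x + 1))) <| by
    filter_upwards [Ioi_mem_nhds hy] with x hx using log_Gamma_add_one hx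
  rw [h1.unique h3]
  ring

/-- log Γ is convex and its slope over [y, y + 1] is log y, so its derivatives at the two endpoints
bracket log y. The next lemma uses the right endpoint. -/
lemma digamma_le_log {y : ℝ} (hy : 0 < y) : digamma y ≤ log y := by
  have h := convexOn_log_Gamma.le_slope_of_hasDerivAt (x := y) (y := y + 1) hy
    (by simp; linarith) (by linarith) (hasDerivAt_log_Gamma hy)
  simp only [slope_def_field, Function.comp, log_Gamma_add_one hy] at h
  simpa using h

lemma log_sub_le_digamma {y : ℝ} (hy : 0 < y) : log y - 1 / y ≤ digamma y := by
  have h := convexOn_log_Gamma.slope_le_of_hasDerivAt (x := y) (y := y + 1) hy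
    (by simp; linarith) (by linarith) (hasDerivAt_log_Gamma (by linarith))
  simp only [slope_def_field, Function.comp, log_Gamma_add_one hy, digamma_add_one hy] at h
  simp only [add_sub_cancel_left, add_sub_cancel_right, div_one] at h
  linarith

/-- **Binet's formula** for the digamma function. -/
theorem phi_eq_neg_binetLaplace {y : ℝ} (hy : 0 < y) : phi y = -binetLaplace y := by
  -- `phi + binetLaplace` has period 1 and is at most 1/z in absolute value, hence vanishes.
  have hstep : ∀ z, 0 < z → phi (z + 1) + binetLaplace (z + 1) = phi z + binetLaplace z := by
    intro z hz
    have h := binetLaplace_sub_add_one hz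
    unfold phi
    rw [digamma_add_one hz]
    have e : 1 / z = 2 * (1 / (2 * z)) := by field_simp
    linarith
  have hn : ∀ n : ℕ, phi (y + n) + binetLaplace (y + n) = phi y + binetLaplace y := by
    intro n
    induction n with
    | zero => simp
    | succ k ih =>
      rw [← ih, ← hstep (y + k) (by positivity)]
      push_cast
      ring_nf
  have hb : ∀ z, 0 < z → |phi z + binetLaplace z| ≤ 1 / z := by
    intro z hz
    have h1 := digamma_le_log hz
    have h2 := log_sub_le_digamma hz
    have h3 := binetLaplace_nonneg z
    have h4 := binetLaplace_le hz
    have e : 1 / z = 2 * (1 / (2 * z)) := by field_simp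
    have e' : 0 < 1 / (2 * z) := by positivity
    unfold phi
    rw [abs_le]
    constructor <;> linarith
  have hlim : Tendsto (fun n : ℕ => 1 / (y + n)) atTop (𝓝 0) := by
    have : Tendsto (fun n : ℕ => y + (n : ℝ)) atTop atTop :=
      tendsto_atTop_add_const_left _ _ tendsto_natCast_atTop_atTop
    simpa only [one_div] using! this.inv_tendsto_atTop
  have : |phi y + binetLaplace y| ≤ 0 :=
    ge_of_tendsto' hlim fun n => by
      rw [← hn n]
      exact hb _ (by positivity)
  have := abs_nonpos_iff.1 this
  linarith

lemma continuousOn_binetKernel_div : ContinuousOn (fun x => binetKernel x / x) (Ioi 0) :=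
  continuousOn_binetKernel.div continuousOn_id fun _ hx => (mem_Ioi.1 hx).ne'

lemma abs_binetKernel_div_le {x : ℝ} (hx : 0 < x) : |binetKernel x / x| ≤ 1 / 4 := by
  rw [abs_of_nonneg (div_nonneg (binetKernel_nonneg hx) hx.le), div_le_iff₀ hx]
  linarith [binetKernel_le_quarter_mul hx]

/-! ### Binet's formula for log Γ -/

/-- The integral in Binet's first formula for `log Γ`. -/
noncomputable def binetIntegral (y : ℝ) : ℝ := ∫ x in Ioi 0, binetKernel x / x * exp (-y * x)

lemma integrableOn_binetKernel_div_mul_exp {y : ℝ} (hy : 0 < y) :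
    IntegrableOn (fun x => binetKernel x / x * exp (-y * x)) (Ioi 0) :=
  integrableOn_mul_exp_neg_mul continuousOn_binetKernel_div (fun _ => abs_binetKernel_div_le) hy

lemma hasDerivAt_binetIntegral {y : ℝ} (hy : 0 < y) :
    HasDerivAt binetIntegral (phi y) y := by
  have key := hasDerivAt_integral_of_dominated_loc_of_deriv_le (μ := volume.restrict (Ioi 0))
    (F := fun y x => binetKernel x / x * exp (-y * x))
    (F' := fun y x => -(binetKernel x * exp (-y * x)))
    (bound := fun x => 1 / 2 * exp (-(y / 2) * x)) (x₀ := y) (s := Ioi (y / 2))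
    (Ioi_mem_nhds (by linarith)) ?_ (integrableOn_binetKernel_div_mul_exp hy) ?_ ?_ ?_ ?_
  · have h := key.2
    rw [integral_neg] at h
    rw [phi_eq_neg_binetLaplace hy]
    exact h
  · filter_upwards [Ioi_mem_nhds hy] with z hz
    exact (integrableOn_binetKernel_div_mul_exp hz).aestronglyMeasurable
  · exact (integrableOn_binetKernel_mul_exp hy).neg.aestronglyMeasurable
  · filter_upwards [ae_restrict_mem measurableSet_Ioi] with x hx z hz
    rw [norm_neg, norm_mul, norm_eq_abs, norm_eq_abs, abs_of_pos (exp_pos _)]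
    have hx' : 0 < x := hx
    have hz' : y / 2 < z := hz
    refine mul_le_mul (abs_binetKernel_le_half hx) (exp_le_exp.2 ?_) (exp_pos _).le (by norm_num)
    nlinarith
  · exact (integrableOn_exp_neg_mul (by linarith)).const_mul _
  · filter_upwards [ae_restrict_mem measurableSet_Ioi] with x hx z _
    have hx' : x ≠ 0 := (mem_Ioi.1 hx).ne'
    have h1 : HasDerivAt (fun z : ℝ => exp (-z * x)) (exp (-z * x) * (-1 * x)) z :=
      ((hasDerivAt_neg z).mul_const x).exp
    refine (h1.const_mul (binetKernel x / x)).congr_deriv ?_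
    field_simp

/-- The remainder in Stirling's formula for `log Γ`. -/
noncomputable def stirlingRemainder (y : ℝ) : ℝ :=
  log (Real.Gamma y) - (y - 1 / 2) * log y + y - log (2 * π) / 2

lemma hasDerivAt_stirlingRemainder {y : ℝ} (hy : 0 < y) :
    HasDerivAt stirlingRemainder (phi y) y := by
  have h := (((hasDerivAt_log_Gamma hy).sub (((hasDerivAt_id y).sub_const (1 / 2)).mul
    (hasDerivAt_log hy.ne'))).add (hasDerivAt_id y)).sub_const (log (2 * π) / 2)
  refine h.congr_deriv ?_
  unfold phi
  simp only [id]
  field_simp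
  ring

lemma tendsto_stirlingRemainder_nat :
    Tendsto (fun n : ℕ => stirlingRemainder ((n : ℝ) + 1)) atTop (𝓝 0) := by
  have h1 := (Stirling.tendsto_stirlingSeq_sqrt_pi.log (by positivity)).comp (tendsto_add_atTop_nat 1)
  -- `stirlingSeq` is normalised by √(2n) and tends to √π; the added constant converts this to the
  -- √(2π) of `stirlingRemainder`.
  have h2 := h1.add_const (log 2 / 2 - log (2 * π) / 2)
  have h3 : log √π + (log 2 / 2 - log (2 * π) / 2) = 0 := by
    rw [log_sqrt pi_pos.le, log_mul two_ne_zero pi_ne_zero]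
    ring
  rw [h3] at h2
  refine h2.congr fun n => ?_
  have hn : (0 : ℝ) < n + 1 := by positivity
  simp only [Function.comp]
  rw [Stirling.log_stirlingSeq_formula, Nat.factorial_succ]
  unfold stirlingRemainder
  rw [Real.Gamma_nat_eq_factorial]
  push_cast
  rw [log_mul hn.ne' (by positivity), log_mul two_ne_zero hn.ne', log_div hn.ne' (exp_ne_zero _),
    log_exp]
  ring

/-- **Binet's first formula** for `log Γ`. -/
theorem binetIntegral_eq_stirlingRemainder {y : ℝ} (hy : 0 < y) :
    binetIntegral y = stirlingRemainder y := by
  -- Both sides have derivative `phi`, so they differ by a constant; along the integers both tend to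
  -- 0.
  have hconst : ∀ z, 0 < z →
      binetIntegral z - stirlingRemainder z = binetIntegral y - stirlingRemainder y := by
    intro z hz
    have hd : ∀ w ∈ Ioi (0 : ℝ),
        HasDerivAt (fun w => binetIntegral w - stirlingRemainder w) 0 w := fun w hw => by
      exact ((hasDerivAt_binetIntegral hw).sub (hasDerivAt_stirlingRemainder hw)).congr_deriv
        (sub_self _)
    exact isOpen_Ioi.is_const_of_deriv_eq_zero isPreconnected_Ioi
      (fun w hw => (hd w hw).differentiableAt.differentiableWithinAt)
      (fun w hw => (hd w hw).deriv) hz hy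
  have hJ : Tendsto (fun n : ℕ => binetIntegral ((n : ℝ) + 1)) atTop (𝓝 0) := by
    refine squeeze_zero_norm (a := fun n : ℕ => 1 / 4 * (1 / ((n : ℝ) + 1))) (fun n => ?_) ?_
    · rw [norm_eq_abs, mul_one_div]
      exact abs_integral_mul_exp_neg_mul_le (fun _ => abs_binetKernel_div_le) (by positivity)
    · simpa using tendsto_one_div_add_atTop_nhds_zero_nat.const_mul (1 / 4 : ℝ)
  have h := hJ.sub tendsto_stirlingRemainder_nat
  have h' := h.congr fun n : ℕ => hconst ((n : ℝ) + 1) (by positivity)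
  have := tendsto_nhds_unique h' tendsto_const_nhds
  linarith

/-! ### The elementary term with γ and log(2πa) -/

lemma continuousAt_digamma_one : ContinuousAt digamma 1 := by
  have hU : IsOpen {s : ℂ | 0 < s.re} := isOpen_lt continuous_const Complex.continuous_re
  have hG : DifferentiableOn ℂ Complex.Gamma {s : ℂ | 0 < s.re} := fun s hs =>
    (Complex.differentiableAt_Gamma s fun m hm => by
      rw [hm] at hs
      simp only [mem_ofPred_eq, Complex.neg_re, Complex.natCast_re] at hs
      linarith [m.cast_nonneg (α := ℝ)]).differentiableWithinAt
  have hc : ContinuousAt (deriv Complex.Gamma) ((1 : ℝ) : ℂ) :=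
    ((hG.deriv hU).differentiableAt (hU.mem_nhds (by simp))).continuousAt
  have hc' : ContinuousAt (fun x : ℝ => (deriv Complex.Gamma (x : ℂ)).re / Real.Gamma x) 1 :=
    (Complex.continuous_re.continuousAt.comp
      (ContinuousAt.comp (f := fun x : ℝ => (x : ℂ)) hc
        Complex.continuous_ofReal.continuousAt)).div
      (differentiableAt_Gamma_of_pos one_pos).continuousAt (by simp)
  refine hc'.congr ?_
  filter_upwards [Ioi_mem_nhds one_pos] with x hx
  have hd : HasDerivAt Complex.Gamma (deriv Complex.Gamma x) x :=
    (hG.differentiableAt (hU.mem_nhds (by simpa using hx))).hasDerivAt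
  have := hd.real_of_complex
  simp only [Complex.Gamma_ofReal, Complex.ofReal_re] at this
  unfold digamma
  rw [this.deriv]

lemma digamma_one : digamma 1 = -eulerMascheroniConstant := by
  unfold digamma
  rw [Real.eulerMascheroniConstant_eq_neg_deriv]
  simp

/-- Binet's formula after rescaling by a. Removing the 1/2 from the kernel leaves ψ(y/a) + a/y =
ψ(y/a + 1), which stays regular as y → 0. -/
lemma integral_mul_boseReg_mul_exp {a y : ℝ} (ha : 0 < a) (hy : 0 < y) :
    ∫ x in Ioi 0, a * boseReg (a * x) * exp (-y * x) = log y - log a - digamma (y / a + 1) := by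
  have hya : 0 < y / a := div_pos hy ha
  have h1 := integral_comp_mul_left_Ioi (fun x => binetKernel x * exp (-(y / a) * x)) 0 ha
  have h2 : ∀ x, binetKernel (a * x) * exp (-(y / a) * (a * x)) =
      a⁻¹ * (a * boseReg (a * x) * exp (-y * x)) + 1 / 2 * exp (-y * x) := by
    intro x
    have : -(y / a) * (a * x) = -y * x := by field_simp
    rw [this]
    unfold binetKernel
    field_simp
  have hI : IntegrableOn (fun x => a * boseReg (a * x) * exp (-y * x)) (Ioi 0) := by
    refine integrableOn_mul_exp_neg_mul (C := a * (1 / 2)) ?_ ?_ hy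
    · exact continuousOn_const.mul (continuousOn_boseReg.comp (by fun_prop)
        fun x hx => mul_pos ha hx)
    · intro x hx
      rw [abs_mul, abs_of_pos ha]
      exact mul_le_mul_of_nonneg_left (abs_boseReg_le_half (mul_pos ha hx)) ha.le
  rw [funext h2, integral_add (hI.const_mul _) ((integrableOn_exp_neg_mul hy).const_mul _),
    integral_const_mul, integral_const_mul, integral_exp_neg_mul hy, mul_zero, smul_eq_mul] at h1
  have h3 := phi_eq_neg_binetLaplace hya
  unfold binetLaplace at h3
  rw [digamma_add_one hya]
  unfold phi at h3
  rw [log_div hy.ne' ha.ne'] at h3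
  set I := ∫ x in Ioi 0, a * boseReg (a * x) * exp (-y * x)
  set K := ∫ x in Ioi 0, binetKernel x * exp (-(y / a) * x)
  have h4 : I = K - a / (2 * y) := by
    field_simp at h1 ⊢
    linarith
  have h5 : 1 / (2 * (y / a)) = a / (2 * y) := by field_simp
  have h6 : 1 / (y / a) = 2 * (a / (2 * y)) := by field_simp
  rw [h5] at h3
  rw [h6]
  linarith

lemma inv_exp_sub_one_le_inv {x : ℝ} (hx : 0 < x) : 1 / (exp x - 1) ≤ 1 / x :=
  one_div_le_one_div_of_le hx (by linarith [add_one_le_exp x])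

lemma inv_exp_sub_one_le_inv_sq {x : ℝ} (hx : 0 < x) : 1 / (exp x - 1) ≤ 2 / x ^ 2 := by
  have h1 := quadratic_le_exp_of_nonneg hx.le
  rw [show 2 / x ^ 2 = 1 / (x ^ 2 / 2) by field_simp]
  exact one_div_le_one_div_of_le (by positivity) (by linarith)

/-- At infinity the summands behave like 1/(2x) and -1/(2x); only their sum is integrable. -/
lemma integrableOn_binetKernel_div_add {a : ℝ} (ha : 0 < a) :
    IntegrableOn (fun x => binetKernel x / x + a * boseReg (a * x) / 2) (Ioi 0) := by
  refine integrableOn_Ioi_of_le_inv_sq (C := 1 / 4 + a / 4) (D := 1 + 1 / a) ?_ ?_ ?_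
  · exact continuousOn_binetKernel_div.add ((continuousOn_const.mul
      (continuousOn_boseReg.comp (by fun_prop) fun x hx => mul_pos ha hx)).div_const _)
  · intro x hx
    refine (abs_add_le _ _).trans (add_le_add (abs_binetKernel_div_le hx) ?_)
    rw [abs_div, abs_mul, abs_of_pos ha, abs_two]
    have := mul_le_mul_of_nonneg_left (abs_boseReg_le_half (mul_pos ha hx)) ha.le
    linarith
  · intro x hx
    have hax : 0 < a * x := mul_pos ha hx
    have e : binetKernel x / x + a * boseReg (a * x) / 2 =
        (1 / (exp x - 1)) * (1 / x) + a / 2 * (1 / (exp (a * x) - 1)) - 1 / x ^ 2 := by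
      unfold binetKernel boseReg
      have := exp_sub_one_pos hx
      have := exp_sub_one_pos hax
      field_simp
      ring
    have b1 : (1 / (exp x - 1)) * (1 / x) ≤ 1 / x ^ 2 := by
      rw [show 1 / x ^ 2 = 1 / x * (1 / x) by field_simp]
      exact mul_le_mul_of_nonneg_right (inv_exp_sub_one_le_inv hx) (by positivity)
    have b2 : a / 2 * (1 / (exp (a * x) - 1)) ≤ 1 / a * (1 / x ^ 2) := by
      refine (mul_le_mul_of_nonneg_left (inv_exp_sub_one_le_inv_sq hax)
        (by positivity)).trans_eq ?_
      field_simp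
    have p1 : 0 ≤ (1 / (exp x - 1)) * (1 / x) :=
      mul_nonneg (one_div_nonneg.2 (exp_sub_one_pos hx).le) (by positivity)
    have p2 : 0 ≤ a / 2 * (1 / (exp (a * x) - 1)) :=
      mul_nonneg (by positivity) (one_div_nonneg.2 (exp_sub_one_pos hax).le)
    have p3 : 0 ≤ 1 / a * (1 / x ^ 2) := by positivity
    have e2 : (1 + 1 / a) / x ^ 2 = 1 / x ^ 2 + 1 / a * (1 / x ^ 2) := by field_simp
    rw [e, e2, abs_le]
    constructor <;> linarith

/-- Abel regularisation: with a factor e^{-yx} both summands are given by Binet's formulas, their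
log y singularities cancel, and y → 0⁺ brings in ψ(1) = -γ. -/
theorem integral_binetKernel_div_add {a : ℝ} (ha : 0 < a) :
    ∫ x in Ioi 0, (binetKernel x / x + a * boseReg (a * x) / 2) =
      (eulerMascheroniConstant - log (2 * π * a)) / 2 := by
  set f : ℝ → ℝ := fun x => binetKernel x / x + a * boseReg (a * x) / 2 with hf
  have hfi : IntegrableOn f (Ioi 0) := integrableOn_binetKernel_div_add ha
  have hlim1 : Tendsto (fun y => ∫ x in Ioi 0, f x * exp (-y * x)) (𝓝[>] 0)
      (𝓝 (∫ x in Ioi 0, f x)) := by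
    refine tendsto_integral_filter_of_dominated_convergence (fun x => ‖f x‖) ?_ ?_ hfi.norm ?_
    · exact Eventually.of_forall fun y =>
        hfi.aestronglyMeasurable.mul (Continuous.aestronglyMeasurable (by fun_prop))
    · filter_upwards [self_mem_nhdsWithin] with y hy
      filter_upwards [ae_restrict_mem measurableSet_Ioi] with x hx
      rw [norm_mul]
      refine mul_le_of_le_one_right (norm_nonneg _) ?_
      rw [norm_eq_abs, abs_of_pos (exp_pos _), exp_le_one_iff]
      have := mul_pos (mem_Ioi.1 hx) (mem_Ioi.1 hy)
      linarith
    · refine Eventually.of_forall fun x => ?_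
      have : Tendsto (fun y : ℝ => f x * exp (-y * x)) (𝓝 0) (𝓝 (f x * exp (-0 * x))) :=
        Continuous.tendsto (by fun_prop) 0
      simp only [neg_zero, zero_mul, exp_zero, mul_one] at this
      exact this.mono_left nhdsWithin_le_nhds
  have hval : ∀ y ∈ Ioi (0 : ℝ), ∫ x in Ioi 0, f x * exp (-y * x) =
      log (Real.Gamma (y + 1)) - y * log y + y - log (2 * π) / 2 - log a / 2
        - digamma (y / a + 1) / 2 := by
    intro y hy
    have hy' : 0 < y := hy
    have hI : IntegrableOn (fun x => a * boseReg (a * x) * exp (-y * x)) (Ioi 0) := by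
      refine integrableOn_mul_exp_neg_mul (C := a * (1 / 2)) ?_ ?_ hy
      · exact continuousOn_const.mul (continuousOn_boseReg.comp (by fun_prop)
          fun x hx => mul_pos ha hx)
      · intro x hx
        rw [abs_mul, abs_of_pos ha]
        exact mul_le_mul_of_nonneg_left (abs_boseReg_le_half (mul_pos ha hx)) ha.le
    have e : (fun x => f x * exp (-y * x)) = fun x => binetKernel x / x * exp (-y * x) +
        (a * boseReg (a * x) * exp (-y * x)) / 2 := by
      funext x
      simp only [hf]
      ring
    have hB := binetIntegral_eq_stirlingRemainder hy'
    unfold binetIntegral stirlingRemainder at hB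
    rw [e, integral_add (integrableOn_binetKernel_div_mul_exp hy') (hI.div_const 2),
      integral_div, integral_mul_boseReg_mul_exp ha hy', hB, log_Gamma_add_one hy']
    ring
  have hlim2 : Tendsto (fun y => log (Real.Gamma (y + 1)) - y * log y + y - log (2 * π) / 2
      - log a / 2 - digamma (y / a + 1) / 2) (𝓝[>] 0)
      (𝓝 ((eulerMascheroniConstant - log (2 * π * a)) / 2)) := by
    have hc : ContinuousAt (fun y => log (Real.Gamma (y + 1)) - y * log y + y - log (2 * π) / 2
      - log a / 2 - digamma (y / a + 1) / 2) 0 := by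
      have c1 : ContinuousAt (fun y : ℝ => log (Real.Gamma (y + 1))) 0 := by
        have : ContinuousAt (fun x => log (Real.Gamma x)) ((fun y : ℝ => y + 1) 0) := by
          simpa using (hasDerivAt_log_Gamma one_pos).continuousAt
        exact ContinuousAt.comp (f := fun y : ℝ => y + 1) this (by fun_prop)
      have c2 : ContinuousAt (fun y : ℝ => digamma (y / a + 1)) 0 := by
        have : ContinuousAt digamma ((fun y : ℝ => y / a + 1) 0) := by
          simpa using continuousAt_digamma_one
        exact ContinuousAt.comp (f := fun y : ℝ => y / a + 1) this (by fun_prop)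
      exact ((((c1.sub continuous_mul_log.continuousAt).add continuousAt_id).sub
        continuousAt_const).sub continuousAt_const).sub (c2.div_const 2)
    have h := hc.tendsto
    simp only [zero_add, zero_div, Real.Gamma_one, log_one, zero_mul, sub_zero, digamma_one,
      add_zero] at h
    have e : 0 - log (2 * π) / 2 - log a / 2 - -eulerMascheroniConstant / 2 =
        (eulerMascheroniConstant - log (2 * π * a)) / 2 := by
      rw [log_mul (by positivity) ha.ne']
      ring
    rw [e] at h
    exact h.mono_left nhdsWithin_le_nhds
  refine tendsto_nhds_unique (hlim1.congr' ?_) hlim2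
  filter_upwards [self_mem_nhdsWithin] with y hy using hval y hy

/-! ### The series as an integral, and the modular relation -/

lemma hasSum_exp_neg_mul {x : ℝ} (hx : 0 < x) :
    HasSum (fun n : ℕ => exp (-((n : ℝ) + 1) * x)) (1 / (exp x - 1)) := by
  have h1 : exp (-x) < 1 := exp_lt_one_iff.2 (by linarith)
  have h := (hasSum_geometric_of_lt_one (exp_pos (-x)).le h1).mul_left (exp (-x))
  have e : exp (-x) * (1 - exp (-x))⁻¹ = 1 / (exp x - 1) := by
    have h0 := exp_sub_one_pos hx
    have := exp_pos x
    rw [exp_neg]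
    have h2 : 1 - (exp x)⁻¹ = (exp x - 1) / exp x := by field_simp
    rw [h2]
    field_simp
  rw [e] at h
  refine h.congr_fun fun n => ?_
  rw [← exp_nat_mul, ← exp_add]
  ring_nf

lemma continuousOn_inv_exp_mul_sub_one {a : ℝ} (ha : 0 < a) :
    ContinuousOn (fun x => 1 / (exp (a * x) - 1)) (Ioi 0) :=
  continuousOn_const.div (by fun_prop) fun _ hx => (exp_sub_one_pos (mul_pos ha hx)).ne'

lemma integrableOn_binetKernel_mul_inv_exp {a : ℝ} (ha : 0 < a) :
    IntegrableOn (fun x => binetKernel x * (1 / (exp (a * x) - 1))) (Ioi 0) := by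
  have habs : ∀ x, 0 < x → |binetKernel x * (1 / (exp (a * x) - 1))| =
      binetKernel x * (1 / (exp (a * x) - 1)) := fun x hx =>
    abs_of_nonneg (mul_nonneg (binetKernel_nonneg hx)
      (one_div_nonneg.2 (exp_sub_one_pos (mul_pos ha hx)).le))
  refine integrableOn_Ioi_of_le_inv_sq (C := 1 / (4 * a)) (D := 1 / a ^ 2)
    (continuousOn_binetKernel.mul (continuousOn_inv_exp_mul_sub_one ha)) ?_ ?_
  · intro x hx
    have hax : 0 < a * x := mul_pos ha hx
    rw [habs x hx]
    refine (mul_le_mul (binetKernel_le_quarter_mul hx) (inv_exp_sub_one_le_inv hax)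
      (one_div_nonneg.2 (exp_sub_one_pos hax).le) (by positivity)).trans_eq ?_
    field_simp
  · intro x hx
    have hax : 0 < a * x := mul_pos ha hx
    rw [habs x hx]
    refine (mul_le_mul (binetKernel_le_half hx) (inv_exp_sub_one_le_inv_sq hax)
      (one_div_nonneg.2 (exp_sub_one_pos hax).le) (by positivity)).trans_eq ?_
    field_simp

lemma hasSum_phi {a : ℝ} (ha : 0 < a) :
    HasSum (fun n : ℕ => phi (((n : ℝ) + 1) * a))
      (-∫ x in Ioi 0, binetKernel x * (1 / (exp (a * x) - 1))) := by
  have hs : ∀ x ∈ Ioi (0 : ℝ), HasSum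
      (fun n : ℕ => binetKernel x * exp (-(((n : ℝ) + 1) * a) * x))
      (binetKernel x * (1 / (exp (a * x) - 1))) := by
    intro x hx
    refine ((hasSum_exp_neg_mul (mul_pos ha hx)).mul_left (binetKernel x)).congr_fun fun n => ?_
    ring_nf
  have h := hasSum_integral_of_dominated_convergence (μ := volume.restrict (Ioi 0))
    (F := fun (n : ℕ) x => binetKernel x * exp (-(((n : ℝ) + 1) * a) * x))
    (f := fun x => binetKernel x * (1 / (exp (a * x) - 1)))
    -- The terms are nonnegative, so they serve as their own dominating series.
    (fun (n : ℕ) x => binetKernel x * exp (-(((n : ℝ) + 1) * a) * x)) ?_ ?_ ?_ ?_ ?_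
  · refine h.neg.congr_fun fun n => ?_
    exact phi_eq_neg_binetLaplace (by positivity)
  · intro n
    exact (integrableOn_binetKernel_mul_exp (by positivity)).aestronglyMeasurable
  · intro n
    filter_upwards [ae_restrict_mem measurableSet_Ioi] with x hx
    rw [norm_eq_abs, abs_of_nonneg (mul_nonneg (binetKernel_nonneg hx) (exp_pos _).le)]
  · filter_upwards [ae_restrict_mem measurableSet_Ioi] with x hx using (hs x hx).summable
  · refine IntegrableOn.congr_fun (integrableOn_binetKernel_mul_inv_exp ha)
      (fun x hx => (hs x hx).tsum_eq.symm) measurableSet_Ioi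
  · filter_upwards [ae_restrict_mem measurableSet_Ioi] with x hx using hs x hx

theorem modularSide_eq_integral {a : ℝ} (ha : 0 < a) :
    modularSide a = -(√a * ∫ x in Ioi 0, boseReg (a * x) * boseReg x) := by
  -- Expand (1/(e^{ax} - 1) - 1/(ax)) K(x) - R(ax)/2: the first product gives the series, the rest
  -- the elementary term.
  have hid : ∀ x ∈ Ioi (0 : ℝ), boseReg (a * x) * boseReg x =
      binetKernel x * (1 / (exp (a * x) - 1)) -
        1 / a * (binetKernel x / x + a * boseReg (a * x) / 2) := by
    intro x hx
    have hx' : 0 < x := hx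
    have h1 := exp_sub_one_pos hx'
    have h2 := exp_sub_one_pos (mul_pos ha hx')
    unfold binetKernel boseReg
    field_simp
    ring
  rw [setIntegral_congr_fun measurableSet_Ioi hid,
    integral_sub (integrableOn_binetKernel_mul_inv_exp ha)
      ((integrableOn_binetKernel_div_add ha).const_mul _),
    integral_const_mul, integral_binetKernel_div_add ha]
  unfold modularSide
  rw [(hasSum_phi ha).tsum_eq]
  field_simp
  ring

theorem modularSide_inv {a : ℝ} (ha : 0 < a) : modularSide a = modularSide a⁻¹ := by
  rw [modularSide_eq_integral ha, modularSide_eq_integral (inv_pos.2 ha)]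
  have h := integral_comp_mul_left_Ioi (fun x => boseReg (a⁻¹ * x) * boseReg x) 0 ha
  simp only [inv_mul_cancel_left₀ ha.ne', mul_zero, smul_eq_mul] at h
  have h2 : ∫ x in Ioi 0, boseReg (a * x) * boseReg x =
      a⁻¹ * ∫ x in Ioi 0, boseReg (a⁻¹ * x) * boseReg x := by
    rw [← h]
    simp only [mul_comm]
  rw [h2, sqrt_inv, ← mul_assoc]
  congr 2
  have := sqrt_pos.2 ha
  field_simp
  rw [sq_sqrt ha.le]

/-! ### The Mellin transform of the Bose kernel -/

/-- The Bose function `1 / (e^x - 1)` with its pole at the origin cut off on `(0, 1]`. -/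
noncomputable def boseCut (x : ℝ) : ℂ :=
  ((1 / (exp x - 1) : ℝ) : ℂ) - indicator (Ioc 0 1) (fun t : ℝ => (t : ℂ) ^ (-1 : ℂ)) x

lemma isBigO_bose_exp :
    (fun x : ℝ => ((1 / (exp x - 1) : ℝ) : ℂ)) =O[atTop] fun x => exp (-1 * x) := by
  refine Asymptotics.IsBigO.of_bound 2 ?_
  filter_upwards [Ici_mem_atTop 1] with x hx
  have hx' : 1 ≤ x := hx
  have h1 : 0 < exp x - 1 := exp_sub_one_pos (by linarith)
  have h2 := add_one_le_exp x
  rw [Complex.norm_real, norm_eq_abs, norm_eq_abs, abs_of_pos (exp_pos _),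
    abs_of_pos (one_div_pos.2 h1), neg_one_mul, exp_neg, div_le_iff₀ h1]
  have := exp_pos x
  field_simp
  linarith

lemma hasMellin_bose {s : ℂ} (hs : 1 < s.re) :
    HasMellin (fun x : ℝ => ((1 / (exp x - 1) : ℝ) : ℂ)) s (Complex.Gamma s * riemannZeta s) := by
  have hs0 : 0 < s.re := by linarith
  constructor
  · refine mellinConvergent_of_isBigO_rpow (a := s.re + 1) (b := 1) ?_ ?_ (by linarith) ?_ hs
    · exact (Complex.continuous_ofReal.comp_continuousOn (continuousOn_const.div (by fun_prop)
        fun x hx => (exp_sub_one_pos hx).ne')).locallyIntegrableOn measurableSet_Ioi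
    · refine Asymptotics.IsBigO.trans (g := fun x => exp (-1 * x)) ?_
        (isLittleO_exp_neg_mul_rpow_atTop one_pos _).isBigO
      exact isBigO_bose_exp
    · refine Asymptotics.IsBigO.of_bound 1 ?_
      filter_upwards [self_mem_nhdsWithin] with x hx
      have hx' : 0 < x := hx
      rw [Complex.norm_real, norm_eq_abs, norm_eq_abs, rpow_neg_one, abs_of_pos (inv_pos.2 hx'),
        abs_of_pos (one_div_pos.2 (exp_sub_one_pos hx')), one_mul, ← one_div]
      exact inv_exp_sub_one_le_inv hx'
  · have h := hasSum_mellin (ι := ℕ) (a := fun _ => 1) (p := fun n => (n : ℝ) + 1)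
      (F := fun x : ℝ => ((1 / (exp x - 1) : ℝ) : ℂ)) (s := s)
      (fun n => Or.inr (by positivity)) hs0 ?_ ?_
    · rw [← h.tsum_eq, zeta_eq_tsum_one_div_nat_add_one_cpow hs, ← tsum_mul_left]
      refine tsum_congr fun n => ?_
      push_cast
      ring
    · intro t ht
      have := Complex.hasSum_ofReal.2 (hasSum_exp_neg_mul ht)
      simpa using this
    · have := (summable_nat_add_iff 1).2 (Real.summable_one_div_nat_rpow.2 hs)
      simpa using this

lemma hasMellin_boseCut {s : ℂ} (hs : 1 < s.re) :
    HasMellin boseCut s (Complex.Gamma s * riemannZeta s - 1 / (s - 1)) := by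
  have h1 := hasMellin_bose hs
  have h2 := hasMellin_cpow_Ioc (-1) (s := s) (by simpa using hs)
  have h := hasMellin_sub h1.1 h2.1
  rw [h1.2, h2.2, ← sub_eq_add_neg] at h
  exact h

lemma boseCut_of_mem {x : ℝ} (hx : x ∈ Ioc (0 : ℝ) 1) : boseCut x = boseReg x := by
  unfold boseCut boseReg
  rw [indicator_of_mem hx, Complex.cpow_neg_one]
  push_cast
  simp

lemma boseCut_of_one_lt {x : ℝ} (hx : 1 < x) : boseCut x = ((1 / (exp x - 1) : ℝ) : ℂ) := by
  unfold boseCut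
  rw [indicator_of_notMem (fun h => h.2.not_gt hx), sub_zero]

lemma boseCut_eq {x : ℝ} (hx : 0 < x) : boseCut x = boseReg x +
    indicator (Ioi 1) (fun t : ℝ => (t : ℂ) ^ (-1 : ℂ)) x := by
  rcases le_or_gt x 1 with h | h
  · rw [boseCut_of_mem ⟨hx, h⟩, indicator_of_notMem (s := Ioi 1) (not_lt.2 h), add_zero]
  · rw [boseCut_of_one_lt h, indicator_of_mem (mem_Ioi.2 h), Complex.cpow_neg_one]
    unfold boseReg
    push_cast
    simp

lemma locallyIntegrableOn_boseCut : LocallyIntegrableOn boseCut (Ioi 0) := by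
  refine LocallyIntegrableOn.sub ?_ ?_
  · exact (Complex.continuous_ofReal.comp_continuousOn (continuousOn_const.div (by fun_prop)
      fun x hx => (exp_sub_one_pos hx).ne')).locallyIntegrableOn measurableSet_Ioi
  · have h : LocallyIntegrableOn (fun t : ℝ => (t : ℂ) ^ (-1 : ℂ)) (Ioi 0) :=
      ContinuousOn.locallyIntegrableOn (fun x hx => (Complex.continuousAt_ofReal_cpow_const _ _
        (Or.inr (mem_Ioi.1 hx).ne')).continuousWithinAt) measurableSet_Ioi
    intro x hx
    obtain ⟨u, hu, hI⟩ := h x hx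
    exact ⟨u, hu, hI.indicator measurableSet_Ioc⟩

lemma isBigO_boseCut_exp : boseCut =O[atTop] fun x => exp (-1 * x) :=
  isBigO_bose_exp.congr' (by
    filter_upwards [Ioi_mem_atTop 1] with x hx using (boseCut_of_one_lt hx).symm) EventuallyEq.rfl

lemma isBigO_boseCut_zero : boseCut =O[𝓝[>] 0] fun x : ℝ => x ^ (-0 : ℝ) := by
  refine Asymptotics.IsBigO.of_bound (1 / 2) ?_
  filter_upwards [Ioc_mem_nhdsGT one_pos] with x hx
  rw [boseCut_of_mem hx, Complex.norm_real]
  simpa using abs_boseReg_le_half hx.1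

lemma differentiableAt_mellin_boseCut {s : ℂ} (hs : 0 < s.re) :
    DifferentiableAt ℂ (mellin boseCut) s :=
  mellin_differentiableAt_of_isBigO_rpow_exp one_pos locallyIntegrableOn_boseCut
    isBigO_boseCut_exp isBigO_boseCut_zero hs

lemma mellinConvergent_boseCut {s : ℂ} (hs : 0 < s.re) : MellinConvergent boseCut s :=
  mellinConvergent_of_isBigO_rpow_exp one_pos locallyIntegrableOn_boseCut
    isBigO_boseCut_exp isBigO_boseCut_zero hs

/-- Analytic continuation from Re s > 1. Cutting off the pole makes the Mellin integral converge on
all of Re s > 0, a region that also contains the critical strip. -/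
lemma mellin_boseCut {s : ℂ} (hs : 0 < s.re) (hs1 : s ≠ 1) :
    mellin boseCut s = Complex.Gamma s * riemannZeta s - 1 / (s - 1) := by
  set U : Set ℂ := {z | 0 < z.re} with hU
  have hUo : IsOpen U := isOpen_lt continuous_const Complex.continuous_re
  have hUc : IsPreconnected U := (convex_halfSpace_re_gt 0).isPreconnected
  have hG : ∀ z ∈ U, DifferentiableAt ℂ Complex.Gamma z := fun z hz =>
    Complex.differentiableAt_Gamma z fun m hm => by
      rw [hm] at hz
      simp only [hU, mem_ofPred_eq, Complex.neg_re, Complex.natCast_re] at hz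
      linarith [m.cast_nonneg (α := ℝ)]
  set A : ℂ → ℂ := fun z => (z - 1) * mellin boseCut z + 1 with hA
  -- Multiplying by s - 1 removes the pole; the value 1 filled in at s = 1 is the residue of ζ times
  -- Γ(1).
  set E : ℂ → ℂ := Function.update
    (fun z => (z - 1) * riemannZeta z * Complex.Gamma z) 1 1 with hE
  have hAd : DifferentiableOn ℂ A U := fun z hz =>
    (((differentiableAt_id.sub_const 1).mul
      (differentiableAt_mellin_boseCut hz)).add_const 1).differentiableWithinAt
  have hEd : DifferentiableOn ℂ E U := by
    refine (Complex.differentiableOn_compl_singleton_and_continuousAt_iff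
      (c := 1) (hUo.mem_nhds (by simp [hU]))).1 ⟨fun z hz => ?_, ?_⟩
    · have hz1 : z ≠ 1 := hz.2
      have : DifferentiableAt ℂ (fun z => (z - 1) * riemannZeta z * Complex.Gamma z) z :=
        ((differentiableAt_id.sub_const 1).mul (differentiableAt_riemannZeta hz1)).mul (hG z hz.1)
      refine (this.congr_of_eventuallyEq ?_).differentiableWithinAt
      filter_upwards [isOpen_ne.mem_nhds hz1] with w hw
      exact Function.update_of_ne hw _ _
    · rw [hE, continuousAt_update_same]
      have h1 : Tendsto Complex.Gamma (𝓝[≠] 1) (𝓝 1) := by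
        have := (hG 1 (by simp [hU])).continuousAt.tendsto
        rw [Complex.Gamma_one] at this
        exact this.mono_left nhdsWithin_le_nhds
      simpa using riemannZeta_residue_one.mul h1
  have heq : EqOn A E U := by
    refine (hAd.analyticOnNhd hUo).eqOn_of_preconnected_of_eventuallyEq (hEd.analyticOnNhd hUo)
      hUc (z₀ := 2) (by simp [hU]) ?_
    have hV : {z : ℂ | 1 < z.re} ∈ 𝓝 (2 : ℂ) :=
      (isOpen_lt continuous_const Complex.continuous_re).mem_nhds (by simp)
    filter_upwards [hV] with z hz
    have hz' : 1 < z.re := hz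
    have hz1 : z ≠ 1 := by rintro rfl; simp at hz'
    have hz2 : z - 1 ≠ 0 := sub_ne_zero.2 hz1
    simp only [hA, hE, Function.update_of_ne hz1, (hasMellin_boseCut hz').2]
    field_simp
    ring
  have h := heq hs
  have hs2 : s - 1 ≠ 0 := sub_ne_zero.2 hs1
  simp only [hA, hE, Function.update_of_ne hs1] at h
  field_simp
  linear_combination h

/-- In the strip `0 < Re s < 1`, the function `Γ(s) ζ(s)` is the Mellin transform of
`1 / (e^x - 1) - 1 / x`. -/
theorem hasMellin_boseReg {s : ℂ} (hs : 0 < s.re) (hs1 : s.re < 1) :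
    HasMellin (fun x => (boseReg x : ℂ)) s (Complex.Gamma s * riemannZeta s) := by
  have hne : s ≠ 1 := by rintro rfl; simp at hs1
  have hne' : s - 1 ≠ 0 := sub_ne_zero.2 hne
  have hre : (s - 2).re < -1 := by simp; linarith
  set T : ℝ → ℂ := indicator (Ioi 1) (fun t : ℝ => (t : ℂ) ^ (-1 : ℂ)) with hT
  have hfun : ∀ x ∈ Ioi (0 : ℝ), (x : ℂ) ^ (s - 1) • T x =
      indicator (Ioi 1) (fun t : ℝ => (t : ℂ) ^ (s - 2)) x := by
    intro x hx
    have hx' : (x : ℂ) ≠ 0 := Complex.ofReal_ne_zero.2 (mem_Ioi.1 hx).ne'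
    by_cases h : x ∈ Ioi (1 : ℝ)
    · rw [hT, indicator_of_mem h, indicator_of_mem h, smul_eq_mul, ← Complex.cpow_add _ _ hx']
      ring_nf
    · rw [hT, indicator_of_notMem h, indicator_of_notMem h, smul_zero]
  -- For Re s < 1 the tail 1/x on (1, ∞) has a Mellin transform, and subtracting it cancels the
  -- polar term of `mellin_boseCut`.
  have hTm : HasMellin T s (-(1 / (s - 1))) := by
    constructor
    · refine IntegrableOn.congr_fun ?_ (fun x hx => (hfun x hx).symm) measurableSet_Ioi
      exact ((integrable_indicator_iff measurableSet_Ioi).2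
        (integrableOn_Ioi_cpow_of_lt hre one_pos)).integrableOn
    · rw [mellin, setIntegral_congr_fun measurableSet_Ioi hfun,
        setIntegral_indicator measurableSet_Ioi, Ioi_inter_Ioi, sup_of_le_right zero_le_one,
        integral_Ioi_cpow_of_lt hre one_pos]
      simp only [Complex.ofReal_one, Complex.one_cpow]
      rw [show s - 2 + 1 = s - 1 by ring, neg_div]
  have h := hasMellin_sub (mellinConvergent_boseCut hs) hTm.1
  rw [hTm.2, mellin_boseCut hs hne, sub_neg_eq_add, sub_add_cancel] at h
  have hc : ∀ x ∈ Ioi (0 : ℝ), (x : ℂ) ^ (s - 1) • (boseCut x - T x) =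
      (x : ℂ) ^ (s - 1) • (boseReg x : ℂ) := by
    intro x hx
    rw [boseCut_eq hx, add_sub_cancel_right]
  refine ⟨IntegrableOn.congr_fun h.1 hc measurableSet_Ioi, ?_⟩
  rw [← h.2, mellin, mellin, setIntegral_congr_fun measurableSet_Ioi hc]

/-! ### The Wiener-Khinchin identity -/

open scoped FourierTransform ComplexConjugate in
lemma fourier_conj_of_real (f : ℝ → ℝ) (ξ : ℝ) :
    𝓕⁻ (fun x => (f x : ℂ)) ξ = conj (𝓕 (fun x => (f x : ℂ)) ξ) := by
  rw [fourierInv_eq', fourier_eq', ← integral_conj]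
  congr 1
  funext x
  simp only [smul_eq_mul, map_mul, Complex.conj_ofReal, ← Complex.exp_conj, Complex.conj_I]
  push_cast
  ring_nf

open scoped FourierTransform Convolution in
/-- The Wiener-Khinchin identity for a bounded continuous integrable real function whose Fourier
transform is square integrable. -/
theorem integral_mul_translate_eq_integral_fourier {f : ℝ → ℝ} (hc : Continuous f)
    (hi : Integrable f) {C : ℝ} (hC : ∀ x, |f x| ≤ C)
    (hF : Integrable fun ξ => ‖𝓕 (fun x => (f x : ℂ)) ξ‖ ^ 2) (v : ℝ) :
    ∫ t, f t * f (t - v) = ∫ ξ, ‖𝓕 (fun x => (f x : ℂ)) ξ‖ ^ 2 * cos (2 * π * ξ * v) := by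
  set F : ℝ → ℂ := fun x => (f x : ℂ) with hFdef
  have hFi : Integrable F := hi.ofReal
  have hFc : Continuous F := Complex.continuous_ofReal.comp hc
  have hFni : Integrable (fun x => F (-x)) := hFi.comp_neg
  -- The autocorrelation is the convolution of F with its reflection, whose transform is the
  -- conjugate of that of F. Fourier inversion then finishes.
  have hFT : 𝓕 (F ⋆[ContinuousLinearMap.mul ℂ ℂ] fun x => F (-x)) =
      fun ξ => ((‖𝓕 F ξ‖ ^ 2 : ℝ) : ℂ) := by
    funext ξ
    rw [fourier_mul_convolution_eq hFi hFni, ← fourierInv_eq_fourier_comp_neg,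
      fourier_conj_of_real, Complex.mul_conj, Complex.normSq_eq_norm_sq]
  have hcont : Continuous (F ⋆[ContinuousLinearMap.mul ℂ ℂ] fun x => F (-x)) := by
    refine BddAbove.continuous_convolution_right_of_integrable _ ?_ hFi (by fun_prop)
    refine ⟨C, ?_⟩
    rintro _ ⟨x, rfl⟩
    simpa [hFdef] using hC (-x)
  have hinv := congrFun (hcont.fourierInv_fourier_eq (hFi.integrable_convolution _ hFni)
    (by rw [hFT]; exact hF.ofReal)) v
  rw [hFT, fourierInv_eq'] at hinv
  have e1 : (F ⋆[ContinuousLinearMap.mul ℂ ℂ] fun x => F (-x)) v =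
      ((∫ t, f t * f (t - v) : ℝ) : ℂ) := by
    rw [← integral_complex_ofReal]
    refine integral_congr_ae (Eventually.of_forall fun t => ?_)
    simp [hFdef]
  rw [e1] at hinv
  have h2 := congrArg Complex.re hinv
  rw [Complex.ofReal_re] at h2
  rw [← h2, ← RCLike.re_eq_complex_re, ← integral_re]
  · refine integral_congr_ae (Eventually.of_forall fun ξ => ?_)
    simp only [smul_eq_mul, RCLike.re_eq_complex_re]
    rw [mul_comm (Complex.exp _), Complex.re_ofReal_mul, Complex.exp_ofReal_mul_I_re]
    congr 2
    simp
    ring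
  · refine (hF.ofReal (𝕜 := ℂ)).bdd_mul (c := 1) (by fun_prop) ?_
    exact Eventually.of_forall fun ξ => (Complex.norm_exp_ofReal_mul_I _).le

-- The L¹ norms of F and F' bound the transform and ξ times it, so its square is O(1/(1 + ξ²)).
open scoped FourierTransform in
lemma integrable_norm_fourier_sq {F : ℝ → ℂ} (hF : Integrable F) (hd : Differentiable ℝ F)
    (hF' : Integrable (deriv F)) : Integrable fun ξ => ‖𝓕 F ξ‖ ^ 2 := by
  have hcont : Continuous (𝓕 F) :=
    VectorFourier.fourierIntegral_continuous Real.continuous_fourierChar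
      (by exact continuous_inner) hF
  set C := ∫ x, ‖F x‖
  set D := ∫ x, ‖deriv F x‖
  refine (integrable_inv_one_add_sq.const_mul (C ^ 2 + D ^ 2)).mono'
    (hcont.norm.pow 2).aestronglyMeasurable (Eventually.of_forall fun ξ => ?_)
  have h1 : ‖𝓕 F ξ‖ ≤ C := VectorFourier.norm_fourierIntegral_le_integral_norm _ _ _ _ _
  have h2 : ‖𝓕 (deriv F) ξ‖ ≤ D := VectorFourier.norm_fourierIntegral_le_integral_norm _ _ _ _ _
  rw [fourier_deriv hF hd hF'] at h2
  simp only [norm_smul, norm_mul, Complex.norm_real, Complex.norm_I, norm_eq_abs, mul_one,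
    abs_of_pos pi_pos, Complex.norm_ofNat] at h2
  have h3 : |ξ| * ‖𝓕 F ξ‖ ≤ D := by
    refine le_trans ?_ h2
    refine mul_le_mul_of_nonneg_right ?_ (norm_nonneg _)
    nlinarith [abs_nonneg ξ, pi_gt_three]
  have h4 : ‖𝓕 F ξ‖ ^ 2 ≤ C ^ 2 := pow_le_pow_left₀ (norm_nonneg _) h1 2
  have h5 : ξ ^ 2 * ‖𝓕 F ξ‖ ^ 2 ≤ D ^ 2 := by
    have := pow_le_pow_left₀ (by positivity) h3 2
    rwa [mul_pow, sq_abs] at this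
  rw [norm_eq_abs, abs_of_nonneg (by positivity), ← div_eq_mul_inv, le_div_iff₀ (by positivity)]
  linarith

/-! ### The kernel in the logarithmic variable -/

lemma integrable_exp_neg_half_abs : Integrable fun u : ℝ => exp (-(|u| / 2)) := by
  rw [← integrableOn_univ, ← Iic_union_Ioi (a := (0 : ℝ))]
  refine IntegrableOn.union ?_ ?_
  · refine IntegrableOn.congr_fun (integrableOn_exp_mul_Iic (a := 1 / 2) (by norm_num) 0)
      (fun x hx => ?_) measurableSet_Iic
    simp only [abs_of_nonpos (mem_Iic.1 hx)]
    ring_nf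
  · refine IntegrableOn.congr_fun (integrableOn_exp_mul_Ioi (a := -(1 / 2)) (by norm_num) 0)
      (fun x hx => ?_) measurableSet_Ioi
    simp only [abs_of_pos (mem_Ioi.1 hx)]
    ring_nf

/-- The function `1 / (e^x - 1) - 1 / x` in the logarithmic variable `x = e^(-u)`, normalised
for the critical line. -/
noncomputable def boseLog (u : ℝ) : ℝ := exp (-(1 / 2) * u) * boseReg (exp (-u))

lemma hasDerivAt_boseLog (u : ℝ) : HasDerivAt boseLog
    (-(1 / 2) * boseLog u - exp (-(1 / 2) * u) * (exp (-u) * boseRegDeriv (exp (-u)))) u := by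
  have h1 : HasDerivAt (fun u : ℝ => exp (-(1 / 2) * u)) (exp (-(1 / 2) * u) * (-(1 / 2) * 1)) u :=
    ((hasDerivAt_id u).const_mul (-(1 / 2))).exp
  have h2 : HasDerivAt (fun u : ℝ => exp (-u)) (exp (-u) * -1) u := (hasDerivAt_neg u).exp
  have h3 := (hasDerivAt_boseReg (exp_pos (-u))).comp u h2
  refine (h1.mul h3).congr_deriv ?_
  unfold boseLog
  simp only [Function.comp]
  ring

lemma continuous_boseLog : Continuous boseLog :=
  continuous_iff_continuousAt.2 fun u => (hasDerivAt_boseLog u).continuousAt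

/-- The first bound on r serves u ≥ 0 (x = e^{-u} near 0), the second u ≤ 0 (x large). -/
lemma exp_neg_half_mul_le_of_le {u r C : ℝ} (h1 : r ≤ C) (h2 : r ≤ C * exp u) :
    exp (-(1 / 2) * u) * r ≤ C * exp (-(|u| / 2)) := by
  rcases le_total 0 u with hu | hu
  · rw [abs_of_nonneg hu]
    refine (mul_le_mul_of_nonneg_left h1 (exp_pos _).le).trans_eq ?_
    rw [mul_comm]
    ring_nf
  · rw [abs_of_nonpos hu]
    refine (mul_le_mul_of_nonneg_left h2 (exp_pos _).le).trans_eq ?_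
    rw [mul_left_comm, ← exp_add]
    ring_nf

lemma abs_boseLog_le (u : ℝ) : |boseLog u| ≤ exp (-(|u| / 2)) := by
  unfold boseLog
  rw [abs_mul, abs_of_pos (exp_pos _), ← one_mul (exp (-(|u| / 2)))]
  refine exp_neg_half_mul_le_of_le ?_ ?_
  · linarith [abs_boseReg_le_half (exp_pos (-u))]
  · have := abs_boseReg_le_inv (exp_pos (-u))
    rwa [one_div, ← exp_neg, neg_neg, ← one_mul (exp u)] at this

lemma integrable_boseLog : Integrable boseLog :=
  integrable_exp_neg_half_abs.mono' continuous_boseLog.aestronglyMeasurable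
    (Eventually.of_forall abs_boseLog_le)

lemma abs_deriv_boseLog_le (u : ℝ) : |deriv boseLog u| ≤ 3 / 2 * exp (-(|u| / 2)) := by
  have hE := exp_pos (-u)
  have h1 := abs_boseLog_le u
  have h0 : 0 ≤ exp (-(1 / 2) * u) * (exp (-u) * boseRegDeriv (exp (-u))) :=
    mul_nonneg (exp_pos _).le (mul_nonneg hE.le (boseRegDeriv_nonneg hE))
  have hb : exp (-u) * boseRegDeriv (exp (-u)) ≤ exp u := by
    refine (mul_le_mul_of_nonneg_left (boseRegDeriv_le_inv_sq _) hE.le).trans_eq ?_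
    rw [exp_neg]
    have := exp_pos u
    field_simp
  have ha : exp (-u) * boseRegDeriv (exp (-u)) ≤ 1 := by
    rcases le_total u 0 with hu | hu
    · exact hb.trans (exp_le_one_iff.2 hu)
    · have h3 := boseRegDeriv_le_quarter hE
      have h4 : exp (-u) ≤ 1 := exp_le_one_iff.2 (by linarith)
      have h5 := boseRegDeriv_nonneg hE
      nlinarith
  have h2 : exp (-(1 / 2) * u) * (exp (-u) * boseRegDeriv (exp (-u))) ≤
      1 * exp (-(|u| / 2)) :=
    exp_neg_half_mul_le_of_le ha (by rwa [one_mul])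
  rw [(hasDerivAt_boseLog u).deriv]
  rw [abs_le] at h1 ⊢
  constructor <;> linarith

open scoped FourierTransform in
lemma integrable_norm_fourier_boseLog_sq :
    Integrable fun ξ => ‖𝓕 (fun u => (boseLog u : ℂ)) ξ‖ ^ 2 := by
  have hd : ∀ u, HasDerivAt (fun u => (boseLog u : ℂ)) ((deriv boseLog u : ℝ) : ℂ) u := fun u =>
    (hasDerivAt_boseLog u).differentiableAt.hasDerivAt.ofReal_comp
  refine integrable_norm_fourier_sq integrable_boseLog.ofReal
    (fun u => (hd u).differentiableAt) ?_
  rw [funext fun u => (hd u).deriv]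
  refine Integrable.ofReal ?_
  exact (integrable_exp_neg_half_abs.const_mul (3 / 2)).mono'
    (measurable_deriv _).aestronglyMeasurable (Eventually.of_forall abs_deriv_boseLog_le)

open scoped FourierTransform in
lemma fourier_boseLog (t : ℝ) : 𝓕 (fun u => (boseLog u : ℂ)) (t / (2 * π)) =
    Complex.Gamma (1 / 2 + Complex.I * t) * riemannZeta (1 / 2 + Complex.I * t) := by
  have hre : (1 / 2 + Complex.I * t).re = 1 / 2 := by simp
  have him : (1 / 2 + Complex.I * t).im = t := by simp
  rw [← (hasMellin_boseReg (s := 1 / 2 + Complex.I * t) (by rw [hre]; norm_num)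
    (by rw [hre]; norm_num)).2, mellin_eq_fourier, hre, him]
  refine congrFun (congrArg _ (funext fun u => ?_)) _
  simp [boseLog]

/-- The substitution x = e^{-u}, read off from the Mellin-Fourier relation at s = 1. -/
lemma integral_exp_neg_mul_comp_exp_neg (k : ℝ → ℝ) :
    ∫ u, exp (-u) * k (exp (-u)) = ∫ x in Ioi 0, k x := by
  have h := mellin_eq_fourier (fun x => (k x : ℂ)) (s := 1)
  rw [mellin, fourier_eq'] at h
  simp only [sub_self, Complex.cpow_zero, one_smul, Complex.one_re, Complex.one_im, zero_div,
    inner_zero_right, mul_zero, Complex.ofReal_zero, zero_mul, Complex.exp_zero,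
    Complex.real_smul, ← Complex.ofReal_mul, integral_complex_ofReal, Complex.ofReal_inj] at h
  rw [h]
  simp

open scoped FourierTransform in
theorem modularSide_eq_integral_fourier {a : ℝ} (ha : 0 < a) :
    modularSide a = -∫ ξ, ‖𝓕 (fun u => (boseLog u : ℂ)) ξ‖ ^ 2 * cos (2 * π * ξ * log a) := by
  have hC : ∀ u, |boseLog u| ≤ 1 := fun u =>
    (abs_boseLog_le u).trans (exp_le_one_iff.2 (by have := abs_nonneg u; linarith))
  rw [← integral_mul_translate_eq_integral_fourier continuous_boseLog integrable_boseLog hC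
    integrable_norm_fourier_boseLog_sq, modularSide_eq_integral ha,
    ← integral_exp_neg_mul_comp_exp_neg, ← integral_const_mul]
  congr 2
  funext t
  have e1 : exp (-(t - log a)) = a * exp (-t) := by
    rw [neg_sub, sub_eq_add_neg, exp_add, exp_log ha]
  -- The factor √a is what the half-density weights of `boseLog` produce under translation by log a.
  have e2 : exp (-(1 / 2) * t) * exp (-(1 / 2) * (t - log a)) = √a * exp (-t) := by
    rw [sqrt_eq_rpow, rpow_def_of_pos ha, ← exp_add, ← exp_add]
    ring_nf
  unfold boseLog
  rw [e1]
  linear_combination (-(boseReg (exp (-t)) * boseReg (a * exp (-t)))) * e2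

/-! ### From Γζ to Ξ, and the integral formula -/

lemma norm_Xi_mul_Gamma_sq (t : ℝ) :
    ‖Xi (t / 2) * Complex.Gamma ((-1 + Complex.I * t) / 4)‖ ^ 2 = (1 + t ^ 2) * (√π / 2) *
      ‖Complex.Gamma (1 / 2 + Complex.I * (t / 2 : ℝ)) *
        riemannZeta (1 / 2 + Complex.I * (t / 2 : ℝ))‖ ^ 2 := by
  unfold Xi xi
  set s : ℂ := 1 / 2 + Complex.I * (t / 2 : ℝ) with hs
  have hw : (-1 + Complex.I * t) / 4 = (s - 1) / 2 := by
    rw [hs]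
    push_cast
    ring
  have hre : s.re = 1 / 2 := by simp [hs]
  have him : s.im = t / 2 := by simp [hs]
  have hw0 : (s - 1) / 2 ≠ 0 := by
    intro h
    have := congrArg Complex.re h
    simp [hre] at this
    norm_num at this
  -- The factor s - 1 of ξ is absorbed here, so that the duplication formula merges the two Gamma
  -- factors into Γ(s).
  have h1 : Complex.Gamma (s / 2 + 1 / 2) = (s - 1) / 2 * Complex.Gamma ((s - 1) / 2) := by
    rw [← Complex.Gamma_add_one _ hw0]
    ring_nf
  have h2 := Complex.Gamma_mul_Gamma_add_half (s / 2)
  rw [h1, mul_div_cancel₀ s two_ne_zero] at h2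
  have h3 : 1 / 2 * s * (s - 1) * (π : ℂ) ^ (-s / 2) * Complex.Gamma (s / 2) * riemannZeta s *
      Complex.Gamma ((s - 1) / 2) = s * (π : ℂ) ^ (-s / 2) * (2 : ℂ) ^ (1 - s) * (√π : ℝ) *
      (Complex.Gamma s * riemannZeta s) := by
    linear_combination s * (π : ℂ) ^ (-s / 2) * riemannZeta s * h2
  have n1 : ‖s‖ ^ 2 = (1 + t ^ 2) / 4 := by
    rw [← Complex.normSq_eq_norm_sq, Complex.normSq_apply, hre, him]
    ring
  have n2 : ‖(π : ℂ) ^ (-s / 2)‖ ^ 2 = (√π)⁻¹ := by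
    rw [Complex.norm_cpow_eq_rpow_re_of_pos pi_pos, ← rpow_natCast, ← rpow_mul pi_pos.le,
      sqrt_eq_rpow, ← rpow_neg pi_pos.le]
    congr 1
    simp [hre]
  have n3 : ‖(2 : ℂ) ^ (1 - s)‖ ^ 2 = 2 := by
    have : (2 : ℂ) = ((2 : ℝ) : ℂ) := by norm_num
    rw [this, Complex.norm_cpow_eq_rpow_re_of_pos two_pos, ← rpow_natCast,
      ← rpow_mul zero_le_two]
    simp [hre]
    norm_num
  have n4 : ‖((√π : ℝ) : ℂ)‖ ^ 2 = √π * √π := by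
    rw [Complex.norm_real, norm_eq_abs, sq_abs, sq]
  rw [hw, h3, norm_mul, norm_mul, norm_mul, norm_mul, mul_pow, mul_pow, mul_pow, mul_pow,
    n1, n2, n3, n4]
  have := sqrt_pos.2 pi_pos
  field_simp
  ring

open scoped FourierTransform in
lemma xiIntegrand_eq (a t : ℝ) : xiIntegrand a t = √π / 2 *
    (‖𝓕 (fun u => (boseLog u : ℂ)) ((4 * π)⁻¹ * t)‖ ^ 2 *
      cos (2 * π * ((4 * π)⁻¹ * t) * log a)) := by
  -- The scale 4π combines the 2π of the Fourier convention with the argument t/2 of Ξ.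
  have e1 : (4 * π)⁻¹ * t = (t / 2) / (2 * π) := by
    field_simp
    ring
  have e2 : 2 * π * ((4 * π)⁻¹ * t) * log a = t / 2 * log a := by
    field_simp
    ring
  unfold xiIntegrand
  rw [e2, e1, fourier_boseLog, norm_Xi_mul_Gamma_sq]
  have : 1 + t ^ 2 ≠ 0 := by positivity
  field_simp

open scoped FourierTransform in
lemma integrable_xiIntegrand (a : ℝ) : Integrable (xiIntegrand a) := by
  have h : Integrable fun ξ => ‖𝓕 (fun u => (boseLog u : ℂ)) ξ‖ ^ 2 *
      cos (2 * π * ξ * log a) := by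
    refine integrable_norm_fourier_boseLog_sq.mul_bdd (c := 1)
      (Continuous.aestronglyMeasurable (by fun_prop)) ?_
    exact Eventually.of_forall fun ξ => abs_cos_le_one _
  rw [funext (xiIntegrand_eq a)]
  exact (h.comp_mul_left' (by positivity : (4 * π)⁻¹ ≠ 0)).const_mul _

open scoped FourierTransform in
theorem modularSide_eq_integral_xiIntegrand {a : ℝ} (ha : 0 < a) :
    modularSide a = -(1 / π ^ (3 / 2 : ℝ)) * ∫ t in Ioi (0 : ℝ), xiIntegrand a t := by
  set f : ℝ → ℝ := fun ξ => ‖𝓕 (fun u => (boseLog u : ℂ)) ξ‖ ^ 2 * cos (2 * π * ξ * log a)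
  -- Since `boseLog` is real, its transform has even modulus, so the integral over ℝ folds to the
  -- half line.
  have hneg : ∀ ξ, f (-ξ) = f ξ := by
    intro ξ
    simp only [f]
    rw [← fourierInv_eq_fourier_neg, fourier_conj_of_real, RCLike.norm_conj]
    congr 1
    rw [← cos_neg]
    ring_nf
  have habs : ∀ ξ, f |ξ| = f ξ := by
    intro ξ
    rcases abs_choice ξ with h | h <;> rw [h]
    exact hneg ξ
  have h1 : ∫ ξ, f ξ = 2 * ∫ ξ in Ioi 0, f ξ := by
    rw [← integral_comp_abs]
    simp only [habs]
  have h2 := integral_comp_mul_left_Ioi f 0 (b := (4 * π)⁻¹) (by positivity)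
  rw [inv_inv, mul_zero, smul_eq_mul] at h2
  have h3 : ∫ t in Ioi (0 : ℝ), xiIntegrand a t = √π / 2 * (4 * π * ∫ ξ in Ioi 0, f ξ) := by
    rw [← h2, ← integral_const_mul]
    exact congrArg _ (funext (xiIntegrand_eq a))
  have hp : π ^ (3 / 2 : ℝ) = π * √π := by
    rw [sqrt_eq_rpow, ← rpow_one_add' pi_pos.le (by norm_num)]
    norm_num
  rw [modularSide_eq_integral_fourier ha, h1, h3, hp]
  have := sqrt_pos.2 pi_pos
  field_simp
  ring

end LostNotebook

theorem corollary1p4 (α β : ℝ) (hα : 0 < α) (hβ : 0 < β) (hαβ : α * β = 1) :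
    Summable (fun n : ℕ => LostNotebook.phi (((n : ℝ) + 1) * α)) ∧
    Summable (fun n : ℕ => LostNotebook.phi (((n : ℝ) + 1) * β)) ∧
    MeasureTheory.IntegrableOn (LostNotebook.xiIntegrand α) (Set.Ioi 0) ∧
    LostNotebook.modularSide α = LostNotebook.modularSide β ∧
    LostNotebook.modularSide β =
      -(1 / Real.pi ^ (3 / 2 : ℝ)) * ∫ t in Set.Ioi (0 : ℝ), LostNotebook.xiIntegrand α t := by
  have hmod : LostNotebook.modularSide α = LostNotebook.modularSide β := by
    rw [LostNotebook.modularSide_inv hα, inv_eq_of_mul_eq_one_right hαβ]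
  exact ⟨(LostNotebook.hasSum_phi hα).summable, (LostNotebook.hasSum_phi hβ).summable,
    (LostNotebook.integrable_xiIntegrand α).integrableOn, hmod,
    hmod ▸ LostNotebook.modularSide_eq_integral_xiIntegrand hα⟩
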